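/- Let $k$ be a field. All algebras are associative unital $k$-algebras, and for an algebra $A$ let $M(A)$ denote the category of all right $A$-modules. Let $A$ be an algebra whose center is $k$, that is, the structure map $k\to A$ is injective with image the center $Z(A)$. Then $A$ is universally Morita cancellative: for every finitely generated commutative $k$-algebra $R$ that is a domain and has an ideal $I\subset R$ such that the composite $k\to R\to R/I$ is an isomorphism, and for every $k$-algebra $B$, if there is an equivalence of abelian categories $M(A\otimes_k R)\cong M(B\otimes_k R)$, then there is an equivalence of abelian categories $M(A)\cong M(B)$. The same holds over $k$: if there is a $k$-linear equivalence $M(A\otimes_k R)\cong M(B\otimes_k R)$, then there is a $k$-linear equivalence $M(A)\cong M(B)$. -/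

import Mathlib

open CategoryTheory
open scoped TensorProduct

universe u

/-- The category `M(A)` of all right `A`-modules, i.e. of left modules over the opposite ring. -/
abbrev RightModuleCat (A : Type u) [Ring A] : Type (u + 1) := ModuleCat.{u} Aᵐᵒᵖ

/-- `M(A)` and `M(B)` are equivalent as abelian categories. An equivalence of categories between
abelian categories is automatically additive and exact, so these are not separate conditions. -/
def AbelianModEquivalent (A B : Type u) [Ring A] [Ring B] : Prop :=
  Nonempty (RightModuleCat A ≌ RightModuleCat B)

/-- `M(A)` and `M(B)` are equivalent as `k`-linear abelian categories. -/
def LinearModEquivalent (k : Type u) [Field k] (A B : Type u) [Ring A] [Algebra k A]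
    [Ring B] [Algebra k B] : Prop :=
  IsMoritaEquivalent k Aᵐᵒᵖ Bᵐᵒᵖ

/-- `A` is universally Morita cancellative: for every finitely generated commutative domain `R`
over `k` with an ideal `I` such that `k → R → R/I` is an isomorphism, and for every algebra `B`,
an equivalence of abelian categories `M(A ⊗ R) ≌ M(B ⊗ R)` implies one `M(A) ≌ M(B)`. -/
def UniversallyMoritaCancellative (k : Type u) [Field k] (A : Type u) [Ring A] [Algebra k A] :
    Prop :=
  ∀ (R : Type u) [CommRing R] [IsDomain R] [Algebra k R] [Algebra.FiniteType k R] (I : Ideal R),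
    Function.Bijective ((Ideal.Quotient.mk I).comp (algebraMap k R)) →
    ∀ (B : Type u) [Ring B] [Algebra k B],
      AbelianModEquivalent (A ⊗[k] R) (B ⊗[k] R) → AbelianModEquivalent A B

/-- The same notion when all categories and equivalences are taken over the base field, that is,
when equivalences are required to be `k`-linear, in the hypothesis and in the conclusion. -/
def LinearlyUniversallyMoritaCancellative (k : Type u) [Field k] (A : Type u) [Ring A]
    [Algebra k A] : Prop :=
  ∀ (R : Type u) [CommRing R] [IsDomain R] [Algebra k R] [Algebra.FiniteType k R] (I : Ideal R),
    Function.Bijective ((Ideal.Quotient.mk I).comp (algebraMap k R)) →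
    ∀ (B : Type u) [Ring B] [Algebra k B],
      LinearModEquivalent k (A ⊗[k] R) (B ⊗[k] R) → LinearModEquivalent k A B

/-! An equivalence identifies the centers of `A ⊗ R` and `B ⊗ R`, giving a ring isomorphism `Φ : R ≅
Z ⊗ R` with `Z = Z(B)`. A rational point `ε` of `R` gives `π : Z ⊗ R → Z`. If `π ∘ Φ` maps `k`
bijectively onto `Z` (`bijective_of_ringEquiv_tensorProduct`), then `π ∘ Φ` is, after untwisting by
this bijection, another rational point `ε'` of `R`. The equivalence respects annihilators in the
centers, so it matches the modules killed by `ker ε'`, which form `M(A)`, with those killed by `ker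
ε`, which form `M(B)`.

The difficulty is that `Φ` need not be `k`-linear. A subfield of `R` is nevertheless algebraic over
`k`, hence lies in `k` because `R` has a rational point; comparing transcendence degrees then forces
`Z` into `k` as well. -/

/-! ### Subfields of finitely generated domains, and the isomorphism `R ≅ Z ⊗ R`. -/

section CommutativeAlgebra

open Polynomial

/-- For `n > deg h` invertible in `k`, `X ^ n - 1` is squarefree and does not divide `h`, so some
prime containing it avoids `h`. -/
theorem Polynomial.exists_isPrime_X_pow_sub_one_mem {k : Type*} [Field k] {h : k[X]} (hh : h ≠ 0) :
    ∃ (n : ℕ) (Q : Ideal k[X]), 0 < n ∧ Q.IsPrime ∧ X ^ n - 1 ∈ Q ∧ h ∉ Q := by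
  -- Of two consecutive integers, at least one is nonzero in `k`.
  obtain ⟨n, hn, hnk⟩ : ∃ n : ℕ, h.natDegree < n ∧ (n : k) ≠ 0 := by
    by_cases h0 : ((h.natDegree + 1 : ℕ) : k) = 0
    · refine ⟨h.natDegree + 2, by omega, fun h1 ↦ one_ne_zero (α := k) ?_⟩
      push_cast at h0 h1
      linear_combination h1 - h0
    · exact ⟨_, Nat.lt_succ_self _, h0⟩
  have hn0 : 0 < n := by omega
  have hrad : IsRadical (X ^ n - 1 : k[X]) :=
    ((X_pow_sub_one_separable_iff (F := k)).2 hnk).squarefree.isRadical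
  have hdvd : ¬ (X ^ n - 1 : k[X]) ∣ h := fun hd ↦ by
    have := natDegree_le_of_dvd hd hh
    rw [← C_1, natDegree_X_pow_sub_C] at this
    omega
  by_contra! H
  apply hdvd
  have hmem : h ∈ (Ideal.span {(X ^ n - 1 : k[X])}).radical := by
    rw [Ideal.radical_eq_sInf, Ideal.mem_sInf]
    rintro Q ⟨hQ, hQp⟩
    exact H n Q hn0 hQp (hQ (Ideal.mem_span_singleton_self _))
  obtain ⟨m, hm⟩ := hmem
  exact hrad m h (Ideal.mem_span_singleton.1 hm)

/-- The elements of a subfield of a finitely generated domain over `k` are algebraic over `k`,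
even if the subfield does not contain `k`. -/
theorem isAlgebraic_of_ringHom_field {k F R : Type*} [Field k] [Field F] [CommRing R] [IsDomain R]
    [Algebra k R] [Algebra.FiniteType k R] (g : F →+* R) (c : F) : IsAlgebraic k (g c) := by
  by_contra hc
  have hinj : Function.Injective (aeval (R := k) (g c)) :=
    transcendental_iff_injective.1 hc
  algebraize [(aeval (R := k) (g c)).toRingHom]
  have : IsScalarTower k k[X] R := .of_algebraMap_eq fun x ↦ (aeval_C (g c) x).symm
  have : Algebra.FiniteType k[X] R := .of_restrictScalars_finiteType k k[X] R
  have : Algebra.FinitePresentation k[X] R := (Algebra.FinitePresentation.of_finiteType).1 this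
  have : FaithfulSMul k[X] R := (faithfulSMul_iff_algebraMap_injective _ _).2 hinj
  -- Torsion-free over a PID is flat, so `Spec R → Spec k[X]` is open and its image contains some
  -- `D(h)` around the generic point.
  have : Module.Flat k[X] R := inferInstance
  have hopen := PrimeSpectrum.isOpenMap_comap_of_hasGoingDown_of_finitePresentation
    (R := k[X]) (S := R) _ isOpen_univ
  obtain ⟨_, ⟨h, rfl⟩, hmem, hsub⟩ :=
    PrimeSpectrum.isTopologicalBasis_basic_opens.exists_subset_of_mem_open
      (Set.mem_image_of_mem _ (Set.mem_univ (⊥ : PrimeSpectrum R))) hopen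
  obtain ⟨n, Q, hn, hQ, hXQ, hhQ⟩ := exists_isPrime_X_pow_sub_one_mem (h := h) <| by
    rintro rfl
    simp at hmem
  obtain ⟨P, -, hP⟩ := hsub (show (⟨Q, hQ⟩ : PrimeSpectrum k[X]) ∈ _ from hhQ)
  have hmemP : g (c ^ n - 1) ∈ P.asIdeal := by
    have : (X ^ n - 1 : k[X]) ∈ (PrimeSpectrum.comap (algebraMap k[X] R) P).asIdeal := by
      rw [hP]; exact hXQ
    have h2 : aeval (g c) (X ^ n - 1 : k[X]) ∈ P.asIdeal := this
    simpa using h2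
  -- The image of a nonzero element of `F` is a unit and cannot lie in a prime; so `c` is a root of
  -- unity.
  have hzero : c ^ n - 1 = 0 := by
    by_contra hne
    exact P.2.ne_top (Ideal.eq_top_of_isUnit_mem _ hmemP ((IsUnit.mk0 _ hne).map g))
  refine hc ⟨X ^ n - 1, (monic_X_pow_sub_C 1 hn.ne').ne_zero, ?_⟩
  simpa using congrArg g hzero

/-- A nonzero algebraic element of a domain over `k` is a unit, but `x - ε x` is killed by `ε`. -/
theorem eq_algebraMap_of_isAlgebraic {k R : Type*} [Field k] [CommRing R] [IsDomain R]
    [Algebra k R] (ε : R →ₐ[k] k) {x : R} (hx : IsAlgebraic k x) : x = algebraMap k R (ε x) := by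
  by_contra hne
  have halg : IsAlgebraic k (x - algebraMap k R (ε x)) := hx.sub (isAlgebraic_algebraMap _)
  have hu := halg.isIntegral.isUnit (sub_ne_zero.2 hne)
  simpa using hu.map ε

theorem AlgebraicIndependent.one_tmul {k R ι : Type*} [Field k] [CommRing R] [Algebra k R]
    {x : ι → R} (hx : AlgebraicIndependent k x) (Z : Type*) [CommRing Z] [Algebra k Z] :
    AlgebraicIndependent Z fun i ↦ (1 : Z) ⊗ₜ[k] x i := by
  let f : Z ⊗[k] MvPolynomial ι k →ₐ[Z] Z ⊗[k] R :=
    Algebra.TensorProduct.map (AlgHom.id Z Z) (MvPolynomial.aeval x)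
  have hf : Function.Injective f :=
    Module.Flat.lTensor_preserves_injective_linearMap (M := Z)
      (MvPolynomial.aeval (R := k) x).toLinearMap hx
  have h : MvPolynomial.aeval (R := Z) (fun i ↦ (1 : Z) ⊗ₜ[k] x i) =
      f.comp (MvPolynomial.algebraTensorAlgEquiv k Z).symm.toAlgHom := by
    ext i
    simp [f]
  rw [AlgebraicIndependent, h]
  exact hf.comp (MvPolynomial.algebraTensorAlgEquiv k Z).symm.injective

/-- An intermediate ring `Z` between a field `K` and a finitely generated domain `R` is algebraic over
`K` as soon as the transcendence degree of `R` over `Z` is at least that over `K`. -/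
theorem isAlgebraic_of_trdeg_le {K Z R : Type u} [Field K] [CommRing Z] [CommRing R] [IsDomain R]
    [Algebra K R] [Algebra.FiniteType K R] (γ : K →+* Z) (j : Z →+* R) (hj : Function.Injective j)
    (hjγ : j.comp γ = algebraMap K R)
    (h : Algebra.trdeg K R ≤ let := j.toAlgebra; Algebra.trdeg Z R) (z : Z) :
    IsAlgebraic K (j z) := by
  let := γ.toAlgebra
  let := j.toAlgebra
  have : IsScalarTower K Z R := .of_algebraMap_eq' hjγ.symm
  have : FaithfulSMul Z R := (faithfulSMul_iff_algebraMap_injective _ _).2 hj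
  have : IsDomain Z := hj.isDomain
  have hadd := trdeg_add_le (R := K) (S := Z) (A := R)
  have hfin : Algebra.trdeg K R < Cardinal.aleph0 := trdeg_lt_aleph0_of_finiteType
  have ha := (self_le_add_right _ _).trans_lt (hadd.trans_lt hfin)
  have hb := (self_le_add_left _ _).trans_lt (hadd.trans_lt hfin)
  have hle := hadd.trans h
  have h0 : Algebra.trdeg K Z = 0 := by
    generalize Algebra.trdeg K Z = a at *
    generalize Algebra.trdeg Z R = b at *
    lift a to ℕ using ha
    lift b to ℕ using hb
    norm_cast at hle ⊢
    omega
  have := trdeg_eq_zero_iff.1 h0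
  exact (Algebra.IsAlgebraic.isAlgebraic (R := K) z).algebraMap

/-- If `Z ⊗ R` and `R` are isomorphic rings, where `R` is a finitely generated domain over `k` with
a rational point, then this identifies `k` with `Z`. -/
theorem bijective_of_ringEquiv_tensorProduct {k R Z : Type u} [Field k] [CommRing R] [IsDomain R]
    [Algebra k R] [Algebra.FiniteType k R] [CommRing Z] [Algebra k Z] (ε : R →ₐ[k] k)
    (π : Z ⊗[k] R →ₐ[Z] Z) (φ : R ≃+* Z ⊗[k] R) :
    Function.Bijective
      (((π : Z ⊗[k] R →+* Z).comp (φ : R →+* Z ⊗[k] R)).comp (algebraMap k R)) := by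
  set γ : k →+* Z := ((π : Z ⊗[k] R →+* Z).comp (φ : R →+* Z ⊗[k] R)).comp (algebraMap k R)
  have : Nontrivial (Z ⊗[k] R) := φ.injective.nontrivial
  have : Nontrivial Z := by
    by_contra hZ
    rw [not_nontrivial_iff_subsingleton] at hZ
    exact not_subsingleton (Z ⊗[k] R) (Module.subsingleton Z _)
  let j : Z →+* R := (φ.symm : Z ⊗[k] R →+* R).comp (algebraMap Z (Z ⊗[k] R))
  have hπj (z : Z) : π (φ (j z)) = z := by
    simpa [j] using π.commutes z
  have hjγ (c : k) : j (γ c) = algebraMap k R c := by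
    have h1 : j (γ c) = algebraMap k R (ε (j (γ c))) :=
      eq_algebraMap_of_isAlgebraic ε (isAlgebraic_of_ringHom_field (k := k) (j.comp γ) c)
    -- Applying `π ∘ φ`, a left inverse of `j`, turns the scalar `ε (j (γ c))` back into its image
    -- under `γ`.
    have h2 : γ c = γ (ε (j (γ c))) := by
      conv_lhs => rw [← hπj (γ c)]
      exact congrArg (fun x ↦ π (φ x)) h1
    rwa [← γ.injective h2] at h1
  refine ⟨γ.injective, fun z ↦ ?_⟩
  have hjinj : Function.Injective j := Function.LeftInverse.injective (g := fun x ↦ π (φ x)) hπj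
  have halg : IsAlgebraic k (j z) := by
    -- A transcendence basis of `R` over `k` stays independent over `Z` in `Z ⊗ R ≅ R`.
    have htr : Algebra.trdeg k R ≤ let := j.toAlgebra; Algebra.trdeg Z R := by
      obtain ⟨s, hs⟩ := exists_isTranscendenceBasis k R
      have hx := hs.1.one_tmul Z
      let := j.toAlgebra
      have := (hx.map' (f := (AlgEquiv.ofRingEquiv (f := φ.symm) fun z ↦ rfl :
        Z ⊗[k] R ≃ₐ[Z] R).toAlgHom) φ.symm.injective).cardinalMk_le_trdeg
      rwa [hs.cardinalMk_eq_trdeg] at this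
    exact isAlgebraic_of_trdeg_le γ j hjinj (RingHom.ext hjγ) htr z
  refine ⟨ε (j z), hjinj ?_⟩
  rw [hjγ, ← eq_algebraMap_of_isAlgebraic ε halg]

end CommutativeAlgebra

/-! ### Centers of module categories, and restriction of equivalences to retracts. -/

section Morita

variable {S T S' T' : Type u} [Ring S] [Ring T] [Ring S'] [Ring T']

/-- The action of the center of a ring on all modules identifies it with the center of the category
of modules. -/
noncomputable def Subring.centerEquivCatCenter (S : Type u) [Ring S] :
    Subring.center S ≃+* CatCenter (ModuleCat.{u} S) :=
  RingEquiv.ofBijective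
    ({ toFun s :=
        { app M := ModuleCat.ofHom
            { toFun m := (s : S) • m
              map_add' := smul_add _
              map_smul' r m := by
                simp only [RingHom.id_apply, ← mul_smul, Subring.mem_center_iff.1 s.2 r]
            }
          naturality M N f := by ext m; exact (f.hom.map_smul (s : S) m).symm }
       map_one' := by ext M m; exact one_smul S m
       map_mul' s t := by
        ext M m
        exact mul_smul (s : S) (t : S) m
       map_zero' := by ext M m; exact zero_smul S m
       map_add' s t := by ext M m; exact add_smul (s : S) (t : S) m } :
      Subring.center S →+* CatCenter (ModuleCat.{u} S))
    (by
      constructor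
      · intro s t h
        have := congrArg (fun z : CatCenter (ModuleCat.{u} S) ↦
          (z.app (ModuleCat.of S S)).hom (1 : S)) h
        ext
        exact (mul_one (s : S)).symm.trans (this.trans (mul_one (t : S)))
      · intro z
        -- Naturality along `S → M`, `1 ↦ m`, determines `z` by its value at `1`.
        have hz (M : ModuleCat.{u} S) (m : M) :
            (z.app M).hom m = ((z.app (ModuleCat.of S S)).hom (1 : S) : S) • m := by
          have := congrArg (fun f ↦ f.hom (1 : S))
            (z.naturality (ModuleCat.ofHom (LinearMap.toSpanSingleton S M m)))
          simpa using this
        refine ⟨⟨(z.app (ModuleCat.of S S)).hom (1 : S), Subring.mem_center_iff.2 fun r ↦ ?_⟩, ?_⟩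
        · have h1 := (z.app (ModuleCat.of S S)).hom.map_smul r (1 : S)
          have h2 := hz (ModuleCat.of S S) (r • (1 : S))
          rw [h1] at h2
          simpa using h2
        · ext M m
          exact (hz M m).symm)

/-- An equivalence between preadditive categories identifies their centers. -/
noncomputable def CategoryTheory.CatCenter.ringEquivOfIsEquivalence {C D : Type*} [Category* C]
    [Category* D] [Preadditive C] [Preadditive D] (L : C ⥤ D) [L.IsEquivalence] [L.Additive] :
    CatCenter C ≃+* CatCenter D :=
  -- An equivalence is a localization at the isomorphisms, so the induced map on centers is the one
  -- for localizations.
  have : L.IsLocalization (MorphismProperty.isomorphisms C) := .of_isEquivalence L _ le_rfl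
  RingEquiv.ofBijective (CatCenter.localizationRingHom L (MorphismProperty.isomorphisms C)) <| by
    constructor
    · intro r s h
      ext X
      apply L.map_injective
      rw [← CatCenter.localization_app r L (MorphismProperty.isomorphisms C),
        ← CatCenter.localization_app s L (MorphismProperty.isomorphisms C)]
      exact congrArg (fun z : CatCenter D ↦ z.app (L.obj X)) h
    · intro z
      refine ⟨{ app X := L.preimage (z.app (L.obj X))
                naturality X Y f := L.map_injective (by simpa using z.naturality (L.map f)) }, ?_⟩
      refine CatCenter.ext_of_localization L (MorphismProperty.isomorphisms C) _ _ fun X ↦ ?_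
      refine (CatCenter.localization_app _ L (MorphismProperty.isomorphisms C) X).trans ?_
      exact L.map_preimage _

theorem CategoryTheory.CatCenter.ringEquivOfIsEquivalence_app {C D : Type*} [Category* C]
    [Category* D] [Preadditive C] [Preadditive D] (L : C ⥤ D) [L.IsEquivalence] [L.Additive]
    (z : CatCenter C) (X : C) :
    (CatCenter.ringEquivOfIsEquivalence L z).app (L.obj X) = L.map (z.app X) :=
  have : L.IsLocalization (MorphismProperty.isomorphisms C) := .of_isEquivalence L _ le_rfl
  CatCenter.localization_app z L (MorphismProperty.isomorphisms C) X

/-- Equivalent module categories are those of rings with isomorphic centers, compatibly with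
annihilators in the centers. -/
theorem ModuleCat.exists_ringEquiv_center (F : ModuleCat.{u} S ⥤ ModuleCat.{u} T)
    [F.IsEquivalence] :
    ∃ φ : Subring.center S ≃+* Subring.center T, ∀ (s : Subring.center S) (M : ModuleCat.{u} S),
      (∀ m : M, (s : S) • m = 0) ↔ ∀ n : F.obj M, (φ s : T) • n = 0 := by
  have : F.Additive := F.additive_of_preserves_binary_products
  refine ⟨((Subring.centerEquivCatCenter S).trans (CatCenter.ringEquivOfIsEquivalence F)).trans
    (Subring.centerEquivCatCenter T).symm, fun s M ↦ ?_⟩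
  set φ := ((Subring.centerEquivCatCenter S).trans (CatCenter.ringEquivOfIsEquivalence F)).trans
    (Subring.centerEquivCatCenter T).symm with hφ
  have hφs : Subring.centerEquivCatCenter T (φ s) =
      CatCenter.ringEquivOfIsEquivalence F (Subring.centerEquivCatCenter S s) := by
    simp [φ]
  have key : ((Subring.centerEquivCatCenter T (φ s)).app (F.obj M)) =
      F.map ((Subring.centerEquivCatCenter S s).app M) := by
    rw [hφs, CatCenter.ringEquivOfIsEquivalence_app]
  have hS : (∀ m : M, (s : S) • m = 0) ↔ (Subring.centerEquivCatCenter S s).app M = 0 :=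
    ⟨fun h ↦ by ext m; exact h m, fun h m ↦ congrArg (fun f : M ⟶ M ↦ f.hom m) h⟩
  have hT : (∀ n : F.obj M, (φ s : T) • n = 0) ↔
      (Subring.centerEquivCatCenter T (φ s)).app (F.obj M) = 0 :=
    ⟨fun h ↦ by ext m; exact h m, fun h m ↦ congrArg (fun f : F.obj M ⟶ F.obj M ↦ f.hom m) h⟩
  rw [hS, hT, key, F.map_eq_zero_iff]

/-- An additive bijection compatible with the scalar multiplications is an isomorphism of modules. -/
def ModuleCat.isoOfAddEquiv {X Y : ModuleCat.{u} S} (e : X ≃+ Y)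
    (h : ∀ (s : S) (x : X), e (s • x) = s • e x) : X ≅ Y :=
  (e.toLinearEquiv h).toModuleIso

/-- An equivalence between module categories which matches the modules over a retract of the first
ring with the modules over a retract of the second ring induces an equivalence between the
categories of modules over the retracts. -/
theorem ModuleCat.isEquivalence_of_retract (F : ModuleCat.{u} S ⥤ ModuleCat.{u} T)
    [F.IsEquivalence] (p : S →+* S') (i : S' →+* S) (hp : ∀ x, p (i x) = x) (q : T →+* T')
    (j : T' →+* T) (hq : ∀ x, q (j x) = x)
    (h : ∀ M : ModuleCat.{u} S, (∀ s, p s = 0 → ∀ m : M, s • m = 0) ↔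
      ∀ t, q t = 0 → ∀ n : F.obj M, t • n = 0) :
    (restrictScalars.{u} p ⋙ F ⋙ restrictScalars.{u} j).IsEquivalence := by
  have hpM (M : ModuleCat.{u} S') : ∀ s, p s = 0 → ∀ m : (restrictScalars.{u} p).obj M, s • m = 0 :=
    fun s hs m ↦ by
      rw [restrictScalars.smul_def, hs, zero_smul]; rfl
  have hqM (M : ModuleCat.{u} T') : ∀ s, q s = 0 → ∀ m : (restrictScalars.{u} q).obj M, s • m = 0 :=
    fun s hs m ↦ by
      rw [restrictScalars.smul_def, hs, zero_smul]; rfl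
  have hkill {T T' : Type u} [Ring T] [Ring T'] (q : T →+* T') (j : T' →+* T)
      (hq : ∀ x, q (j x) = x) (N : ModuleCat.{u} T)
      (hN : ∀ t, q t = 0 → ∀ n : N, t • n = 0) (t : T) (n : N) : t • n = j (q t) • n := by
    rw [← sub_eq_zero, ← sub_smul]
    exact hN _ (by rw [map_sub, hq, sub_self]) n
  have hiso {T T' : Type u} [Ring T] [Ring T'] (q : T →+* T') (j : T' →+* T)
      (hq : ∀ x, q (j x) = x) (N : ModuleCat.{u} T)
      (hN : ∀ t, q t = 0 → ∀ n : N, t • n = 0) :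
      Nonempty ((restrictScalars.{u} q).obj ((restrictScalars.{u} j).obj N) ≅ N) :=
    ⟨isoOfAddEquiv (AddEquiv.refl N) fun t n ↦ (hkill q j hq N hN t n).symm⟩
  have hfull : (restrictScalars.{u} p ⋙ F ⋙ restrictScalars.{u} j).Full := by
    refine ⟨fun {M M'} g ↦ ?_⟩
    -- On both sides `T` acts through `q`, so a `T'`-linear map is already `T`-linear.
    let g' : F.obj ((restrictScalars.{u} p).obj M) ⟶ F.obj ((restrictScalars.{u} p).obj M') :=
      ofHom
        { toFun := g.hom
          map_add' := g.hom.map_add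
          map_smul' t n :=
            (congrArg g.hom (hkill q j hq _ ((h _).1 (hpM M)) t n)).trans <|
              (g.hom.map_smul (q t) n).trans (hkill q j hq _ ((h _).1 (hpM M')) t _).symm }
    obtain ⟨f, hf⟩ := F.map_surjective g'
    refine ⟨ofHom
      { toFun := f.hom
        map_add' := f.hom.map_add
        map_smul' s m := by
          have := f.hom.map_smul (i s) m
          change f.hom (p (i s) • (show M from m)) = p (i s) • (show M' from f.hom m) at this
          rwa [hp] at this }, ?_⟩
    ext n
    exact congrArg (fun f ↦ f.hom n) hf
  have hess : (restrictScalars.{u} p ⋙ F ⋙ restrictScalars.{u} j).EssSurj := by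
    refine ⟨fun N ↦ ?_⟩
    let M := F.objPreimage ((restrictScalars.{u} q).obj N)
    let e : F.obj M ≅ (restrictScalars.{u} q).obj N := F.objObjPreimageIso _
    have hM : ∀ s, p s = 0 → ∀ m : M, s • m = 0 := by
      refine (h M).2 fun t ht n ↦ e.toLinearEquiv.injective ?_
      rw [map_smul, map_zero, hqM N t ht]
    obtain ⟨e'⟩ := hiso p i hp M hM
    refine ⟨(restrictScalars.{u} i).obj M, ⟨(restrictScalars.{u} j).mapIso (F.mapIso e' ≪≫ e) ≪≫
      ((restrictScalarsComp' j q _ rfl).symm ≪≫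
        restrictScalarsId' (q.comp j) (RingHom.ext hq)).app N⟩⟩
  exact { }

end Morita

/-! ### Rational points of `R` and the cancellation argument. -/

section Cancellation

open Algebra.TensorProduct MulOpposite

variable {k : Type u} [Field k] {R : Type u} [CommRing R] [Algebra k R]

/-- The center of `(A ⊗ R)ᵐᵒᵖ` is `Z(A) ⊗ R` when `R` is commutative. -/
theorem exists_centerTensorEquiv (A : Type u) [Ring A] [Algebra k A] :
    ∃ ψ : Subalgebra.center k A ⊗[k] R ≃+* Subring.center (A ⊗[k] R)ᵐᵒᵖ,
      ∀ w, (ψ w : (A ⊗[k] R)ᵐᵒᵖ) = op (map (Subalgebra.center k A).val (AlgHom.id k R) w) := by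
  set ι := map (Subalgebra.center k A).val (AlgHom.id k R) with hι
  have hinj : Function.Injective ι :=
    Module.Flat.rTensor_preserves_injective_linearMap (M := R)
      (Subalgebra.center k A).val.toLinearMap Subtype.val_injective
  have hmem (x : A ⊗[k] R) : x ∈ ι.range ↔ ∀ y, y * x = x * y := by
    rw [hι, ← Subalgebra.centralizer_coe_range_includeLeft_eq_center_tensorProduct,
      Subalgebra.mem_centralizer_iff]
    refine ⟨fun h y ↦ ?_, fun h y _ ↦ h y⟩
    have hR (r : R) (z : A ⊗[k] R) : Commute (1 ⊗ₜ r) z := by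
      induction z with
      | zero => exact Commute.zero_right _
      | tmul a s => simp [Commute, SemiconjBy, mul_comm]
      | add z w hz hw => exact hz.add_right hw
    induction y with
    | zero => simp
    | tmul a r =>
      have ha : Commute (a ⊗ₜ[k] (1 : R)) x := h _ ⟨a, rfl⟩
      have := ha.mul_left (hR r x)
      simpa using this.eq
    | add y z hy hz => rw [add_mul, mul_add, hy, hz]
  have hcenter (w) : op (ι w) ∈ Subring.center (A ⊗[k] R)ᵐᵒᵖ := by
    refine Subring.mem_center_iff.2 fun y ↦ unop_injective ?_
    simpa using ((hmem (ι w)).1 ⟨w, rfl⟩ y.unop).symm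
  let f : Subalgebra.center k A ⊗[k] R →+* Subring.center (A ⊗[k] R)ᵐᵒᵖ :=
    { toFun w := ⟨op (ι w), hcenter w⟩
      map_one' := by ext; simp
      map_mul' x y := by
        -- `op` reverses products; commutativity of the source compensates.
        rw [mul_comm]
        ext
        simp
      map_zero' := by ext; simp
      map_add' x y := by ext; simp }
  refine ⟨RingEquiv.ofBijective f ⟨fun x y h ↦ ?_, fun y ↦ ?_⟩, fun w ↦ rfl⟩
  · exact hinj (op_injective (congrArg Subtype.val h))
  · obtain ⟨w, hw⟩ := (hmem y.1.unop).2 fun x ↦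
      op_injective (by simpa using (Subring.mem_center_iff.1 y.2 (op x)).symm)
    exact ⟨w, Subtype.ext (unop_injective hw)⟩

/-- The retraction `A ⊗ R → A` given by a rational point of `R`. -/
noncomputable def evalPoint (A : Type u) [Ring A] [Algebra k A] (ε : R →ₐ[k] k) :
    A ⊗[k] R →ₐ[k] A :=
  (Algebra.TensorProduct.rid k k A).toAlgHom.comp (map (AlgHom.id k A) ε)

@[simp]
theorem evalPoint_tmul {A : Type u} [Ring A] [Algebra k A] (ε : R →ₐ[k] k) (a : A) (r : R) :
    evalPoint A ε (a ⊗ₜ r) = ε r • a := by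
  simp [evalPoint]

/-- A right module over `A ⊗ R` is a module over `A` if it is killed by the maximal ideal of `R`. -/
theorem forall_evalPoint_eq_zero_smul_iff {A : Type u} [Ring A] [Algebra k A] (ε : R →ₐ[k] k)
    (M : ModuleCat.{u} (A ⊗[k] R)ᵐᵒᵖ) :
    (∀ s, (evalPoint A ε).op s = 0 → ∀ m : M, s • m = 0) ↔
      ∀ r, ε r = 0 → ∀ m : M, op ((1 : A) ⊗ₜ[k] r) • m = 0 := by
  refine ⟨fun h r hr ↦ h _ (by simp [hr]), fun h ↦ ?_⟩
  have key (x : A ⊗[k] R) (m : M) : op x • m = op (evalPoint A ε x ⊗ₜ[k] (1 : R)) • m := by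
    induction x with
    | zero => simp
    | tmul a r =>
      have h1 := h (r - algebraMap k R (ε r)) (by simp) (op (a ⊗ₜ[k] (1 : R)) • m)
      rw [TensorProduct.tmul_sub, MulOpposite.op_sub, sub_smul, sub_eq_zero, ← mul_smul, ← mul_smul,
        ← MulOpposite.op_mul, ← MulOpposite.op_mul] at h1
      simpa [Algebra.algebraMap_eq_smul_one, TensorProduct.smul_tmul'] using h1
    | add x y hx hy => 
      rw [MulOpposite.op_add, add_smul, hx, hy, map_add, TensorProduct.add_tmul,
        MulOpposite.op_add, add_smul]
  intro s hs m
  have hs' : evalPoint A ε s.unop = 0 := op_injective hs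
  rw [← op_unop s, key, hs', TensorProduct.zero_tmul, op_zero, zero_smul]

/-- An equivalence between the categories of right modules over `A ⊗ R` and `B ⊗ R` induces one
between right modules over `A` and `B`, when `A` is central and `R` has a rational point. -/
theorem exists_isEquivalence_of_isEquivalence_tensorProduct [IsDomain R] [Algebra.FiniteType k R]
    (ε : R →ₐ[k] k) {A B : Type u} [Ring A] [Algebra k A] [Ring B] [Algebra k B]
    (hcenter : Function.Bijective (algebraMap k (Subalgebra.center k A)))
    (F : ModuleCat.{u} (A ⊗[k] R)ᵐᵒᵖ ⥤ ModuleCat.{u} (B ⊗[k] R)ᵐᵒᵖ) [F.IsEquivalence] :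
    ∃ p : (A ⊗[k] R)ᵐᵒᵖ →ₐ[k] Aᵐᵒᵖ,
      (ModuleCat.restrictScalars.{u} p.toRingHom ⋙ F ⋙ ModuleCat.restrictScalars.{u}
        (includeLeft : B →ₐ[k] B ⊗[k] R).op.toRingHom).IsEquivalence := by
  obtain ⟨φ, hφ⟩ := ModuleCat.exists_ringEquiv_center F
  obtain ⟨ψA, hψA⟩ := exists_centerTensorEquiv (k := k) (R := R) A
  obtain ⟨ψB, hψB⟩ := exists_centerTensorEquiv (k := k) (R := R) B
  let eA : R ≃+* Subalgebra.center k A ⊗[k] R :=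
    ((Algebra.TensorProduct.lid k R).symm.trans
      (congr (AlgEquiv.ofBijective (Algebra.ofId k (Subalgebra.center k A)) hcenter)
        AlgEquiv.refl)).toRingEquiv
  have heA (r : R) : eA r = 1 ⊗ₜ r := by simp [eA]
  let Φ : R ≃+* Subalgebra.center k B ⊗[k] R := ((eA.trans ψA).trans φ).trans ψB.symm
  let π : Subalgebra.center k B ⊗[k] R →ₐ[Subalgebra.center k B] Subalgebra.center k B :=
    lift (Algebra.ofId _ _) ((Algebra.ofId k _).comp ε) fun _ _ ↦ mul_comm _ _
  have hπ (z : Subalgebra.center k B) (r : R) : π (z ⊗ₜ r) = ε r • z := by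
    simp [π, Algebra.smul_def, mul_comm, Algebra.ofId_apply]
  have hbij := bijective_of_ringEquiv_tensorProduct ε π Φ
  let γ : k ≃+* Subalgebra.center k B := RingEquiv.ofBijective _ hbij
  have hγ (c : k) : γ c = π (Φ (algebraMap k R c)) := rfl
  -- Composing with the inverse of `γ` makes `π ∘ Φ` `k`-linear without changing its kernel.
  let ε' : R →ₐ[k] k :=
    { (γ.symm : Subalgebra.center k B →+* k).comp
        ((π : Subalgebra.center k B ⊗[k] R →+* _).comp (Φ : R →+* _)) with
      commutes' c := γ.symm_apply_eq.2 (hγ c).symm }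
  have hε' (r : R) : ε' r = 0 ↔ π (Φ r) = 0 := γ.symm.map_eq_zero_iff (x := π (Φ r))
  refine ⟨(evalPoint A ε').op, ModuleCat.isEquivalence_of_retract F _
    (includeLeft : A →ₐ[k] A ⊗[k] R).op.toRingHom (fun x ↦ unop_injective (by simp))
    (evalPoint B ε).op.toRingHom _ (fun x ↦ unop_injective (by simp)) fun M ↦ ?_⟩
  refine (forall_evalPoint_eq_zero_smul_iff ε' M).trans
    (Iff.trans ?_ (forall_evalPoint_eq_zero_smul_iff ε (F.obj M)).symm)
  have hΦ (r : R) : (∀ m : M, op ((1 : A) ⊗ₜ[k] r) • m = 0) ↔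
      ∀ n : F.obj M, op (map (Subalgebra.center k B).val (AlgHom.id k R) (Φ r)) • n = 0 := by
    have h1 := hφ (ψA (eA r)) M
    have h2 : φ (ψA (eA r)) = ψB (Φ r) := by simp [Φ]
    rw [h2, hψA, hψB, heA] at h1
    simpa using h1
  have hπB (w : Subalgebra.center k B ⊗[k] R) :
      evalPoint B ε (map (Subalgebra.center k B).val (AlgHom.id k R) w) = π w := by
    induction w with
    | zero => simp
    | tmul z r => simp [hπ]
    | add x y hx hy => simp [hx, hy]
  constructor
  · intro h r hr n
    have h1 := (hΦ (Φ.symm (1 ⊗ₜ r))).1 (h _ ((hε' _).2 (by simp [hπ, hr]))) n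
    simpa using h1
  · intro h r hr
    refine (hΦ r).2 ((forall_evalPoint_eq_zero_smul_iff ε (F.obj M)).2 h _ ?_)
    exact unop_injective (by simpa [(hε' r).1 hr] using hπB (Φ r))

end Cancellation

theorem theorem0p4 (k : Type u) [Field k] (A : Type u) [Ring A] [Algebra k A]
    (hcenter : Function.Bijective (algebraMap k (Subalgebra.center k A))) :
    UniversallyMoritaCancellative k A ∧ LinearlyUniversallyMoritaCancellative k A := by
  have hpoint (R : Type u) [CommRing R] [Algebra k R] (I : Ideal R)
      (hI : Function.Bijective ((Ideal.Quotient.mk I).comp (algebraMap k R))) :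
      Nonempty (R →ₐ[k] k) :=
    ⟨((AlgEquiv.ofBijective (Algebra.ofId k (R ⧸ I)) hI).symm : (R ⧸ I) →ₐ[k] k).comp
      (Ideal.Quotient.mkₐ k I)⟩
  constructor
  · rintro R _ _ _ _ I hI B _ _ ⟨e⟩
    obtain ⟨ε⟩ := hpoint R I hI
    obtain ⟨p, hp⟩ := exists_isEquivalence_of_isEquivalence_tensorProduct ε hcenter e.functor
    exact ⟨@Functor.asEquivalence _ _ _ _ _ hp⟩
  · rintro R _ _ _ _ I hI B _ _ ⟨⟨e, he⟩⟩
    obtain ⟨ε⟩ := hpoint R I hI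
    obtain ⟨p, hp⟩ := exists_isEquivalence_of_isEquivalence_tensorProduct ε hcenter e.functor
    -- Both restrictions are along `k`-algebra maps, so the composite is `k`-linear when `e` is.
    exact ⟨⟨@Functor.asEquivalence _ _ _ _ _ hp, inferInstanceAs <| Functor.Linear k <|
      ModuleCat.restrictScalars.{u} p.toRingHom ⋙ e.functor ⋙ ModuleCat.restrictScalars.{u}
        (Algebra.TensorProduct.includeLeft : B →ₐ[k] B ⊗[k] R).op.toRingHom⟩⟩
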